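/- Let $n\ge 2$. For $\alpha\in\mathbb R$ let $\mathcal P_{n,\alpha}=\mathbb C\langle p_1,\dots,p_n \mid p_i^2=p_i=p_i^*,\ p_1+\dots+p_n=\alpha e\rangle$ be the unital $*$-algebra generated by $n$ projections with sum $\alpha e$. A $*$-representation $\pi$ of $\mathcal P_{n,\alpha}$ on a complex Hilbert space $H$ is a unital $*$-homomorphism $\mathcal P_{n,\alpha}\to B(H)$; put $P_i=\pi(p_i)$. It is irreducible if $0$ and $H$ are the only closed subspaces of $H$ invariant under all $P_i$, and $\pi$ on $H$, $\pi'$ on $H'$ are equivalent if there is a unitary $U:H\to H'$ with $UP_i=P_i'U$ for all $i$. Let $S_\pi=(H;P_1H,\dots,P_nH)$ be the associated system of $n$ subspaces. A system $S=(H;H_1,\dots,H_n)$ is transitive if the only operators $R\in B(H)$ with $R(H_i)\subset H_i$ for $i=1,\dots,n$ are the scalar operators $\lambda I_H$, $\lambda\in\mathbb C$; systems $S$ and $S'=(H';H_1',\dots,H_n')$ are isomorphic if there is a bounded linear bijection $R:H\to H'$ with bounded inverse such that $R(H_i)=H_i'$ for $i=1,\dots,n$. The discrete spectrum $D_n$ is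 the following set: $D_2=\{0,1,2\}$, $D_3=\{0,1,\tfrac32,2,3\}$, and for $n\ge 4$, $D_n=\Lambda_n^0\cup\Lambda_n^1\cup(n-\Lambda_n^1)\cup(n-\Lambda_n^0)$, where $$\Lambda_n^0=\{0\}\cup\{1+1/c_k : k\ge 0\},\quad c_0=n-1,\ \ c_{k+1}=(n-2)-1/c_k,$$ $$\Lambda_n^1=\{1\}\cup\{1+1/d_k : k\ge 0\},\quad d_0=n-2,\ \ d_{k+1}=(n-2)-1/d_k.$$ Then: (1) for every $\alpha\in D_n$ and every irreducible $*$-representation $\pi$ of $\mathcal P_{n,\alpha}$, the system $S_\pi$ is transitive; (2) for all $\alpha,\alpha'\in D_n$ and all irreducible $*$-representations $\pi$ of $\mathcal P_{n,\alpha}$ and $\pi'$ of $\mathcal P_{n,\alpha'}$ that are not equivalent, the systems $S_\pi$ and $S_{\pi'}$ are not isomorphic. -/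

import Mathlib

universe u v

noncomputable section

/-! ### The `*`-algebra generated by `n` self-adjoint idempotents with sum `α e` -/

/-- The free unital complex algebra on the letters `p_1, …, p_n`. -/
def FreeStarAlg (n : ℕ) : Type := MonoidAlgebra ℂ (FreeMonoid (Fin n))

namespace FreeStarAlg

instance (n : ℕ) : Ring (FreeStarAlg n) :=
  inferInstanceAs (Ring (MonoidAlgebra ℂ (FreeMonoid (Fin n))))

instance (n : ℕ) : Algebra ℂ (FreeStarAlg n) :=
  inferInstanceAs (Algebra ℂ (MonoidAlgebra ℂ (FreeMonoid (Fin n))))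

/-- The letter `p_i`. -/
def letter {n : ℕ} (i : Fin n) : FreeStarAlg n :=
  MonoidAlgebra.of ℂ (FreeMonoid (Fin n)) (FreeMonoid.of i)

/-- The involution as a ring homomorphism into the opposite ring: it conjugates the
coefficients, reverses the words, and fixes every letter. -/
def starHom (n : ℕ) : FreeStarAlg n →+* (FreeStarAlg n)ᵐᵒᵖ :=
  MonoidAlgebra.liftNCRingHom
    ((algebraMap ℂ (FreeStarAlg n)ᵐᵒᵖ).comp (starRingEnd ℂ))
    (FreeMonoid.lift fun i : Fin n => MulOpposite.op (letter i))
    fun x _ => Algebra.commutes (starRingEnd ℂ x) _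

theorem starHom_algebraMap {n : ℕ} (c : ℂ) :
    starHom n (algebraMap ℂ (FreeStarAlg n) c)
      = MulOpposite.op (algebraMap ℂ (FreeStarAlg n) (starRingEnd ℂ c)) := by
  refine (MonoidAlgebra.liftNCRingHom_single _ _ _ (1 : FreeMonoid (Fin n)) c).trans ?_
  rw [map_one, mul_one]
  rfl

theorem starHom_letter {n : ℕ} (i : Fin n) :
    starHom n (letter i) = MulOpposite.op (letter i) := by
  refine (MonoidAlgebra.liftNCRingHom_single _ _ _ (FreeMonoid.of i) (1 : ℂ)).trans ?_
  rw [map_one, one_mul, FreeMonoid.lift_eval_of]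

theorem induction {n : ℕ} {motive : FreeStarAlg n → Prop}
    (hc : ∀ c : ℂ, motive (algebraMap ℂ _ c)) (hl : ∀ i, motive (letter i))
    (hadd : ∀ a b, motive a → motive b → motive (a + b))
    (hmul : ∀ a b, motive a → motive b → motive (a * b)) (a : FreeStarAlg n) : motive a := by
  refine MonoidAlgebra.induction_on (motive := motive) a (fun w => ?_) hadd (fun r f hf => ?_)
  · induction w using FreeMonoid.inductionOn' with
    | one => rw [map_one]; exact (map_one (algebraMap ℂ (FreeStarAlg n))) ▸ hc 1
    | of_mul i w ih => rw [map_mul]; exact hmul _ _ (hl i) ih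
  · exact (Algebra.smul_def (A := FreeStarAlg n) r f) ▸ hmul _ _ (hc r) hf

instance (n : ℕ) : StarRing (FreeStarAlg n) where
  star a := (starHom n a).unop
  star_involutive a := by
    induction a using FreeStarAlg.induction with
    | hc c => simp [starHom_algebraMap]
    | hl i => simp [starHom_letter]
    | hadd a b ha hb => simp [ha, hb]
    | hmul a b ha hb => simp [ha, hb]
  star_mul a b := by simp
  star_add a b := by simp

theorem star_letter {n : ℕ} (i : Fin n) : star (letter i) = letter i :=
  congrArg MulOpposite.unop (starHom_letter i)

theorem star_algebraMap {n : ℕ} (c : ℂ) :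
    star (algebraMap ℂ (FreeStarAlg n) c) = algebraMap ℂ _ (starRingEnd ℂ c) :=
  congrArg MulOpposite.unop (starHom_algebraMap c)

end FreeStarAlg

/-- The defining relations `p_i² = p_i` and `p_1 + ⋯ + p_n = α e`
(the relations `p_i^* = p_i` already hold in the free `*`-algebra). -/
inductive ProjSumRel (n : ℕ) (α : ℝ) : FreeStarAlg n → FreeStarAlg n → Prop
  | idem (i : Fin n) :
      ProjSumRel n α (FreeStarAlg.letter i * FreeStarAlg.letter i) (FreeStarAlg.letter i)
  | sum : ProjSumRel n α (∑ i, FreeStarAlg.letter i) (algebraMap ℂ (FreeStarAlg n) (α : ℂ))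

/-- The algebra
`P_{n,α} = ℂ⟨p_1, …, p_n | p_i² = p_i = p_i^*, p_1 + ⋯ + p_n = α e⟩`. -/
def ProjSumAlg (n : ℕ) (α : ℝ) : Type := RingQuot (ProjSumRel n α)

namespace ProjSumAlg

instance (n : ℕ) (α : ℝ) : Ring (ProjSumAlg n α) :=
  inferInstanceAs (Ring (RingQuot (ProjSumRel n α)))

instance (n : ℕ) (α : ℝ) : Algebra ℂ (ProjSumAlg n α) :=
  inferInstanceAs (Algebra ℂ (RingQuot (ProjSumRel n α)))

/-- The quotient map from the free algebra. -/
def mk (n : ℕ) (α : ℝ) : FreeStarAlg n →ₐ[ℂ] ProjSumAlg n α :=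
  RingQuot.mkAlgHom ℂ (ProjSumRel n α)

theorem mk_surjective (n : ℕ) (α : ℝ) : Function.Surjective (mk n α) :=
  RingQuot.mkAlgHom_surjective ℂ (ProjSumRel n α)

theorem mk_rel {n : ℕ} {α : ℝ} {a b : FreeStarAlg n} (h : ProjSumRel n α a b) :
    mk n α a = mk n α b :=
  RingQuot.mkAlgHom_rel ℂ h

/-- The generator `p_i` of `P_{n,α}`. -/
def gen {n : ℕ} {α : ℝ} (i : Fin n) : ProjSumAlg n α := mk n α (FreeStarAlg.letter i)

theorem mk_star_rel {n : ℕ} {α : ℝ} {a b : FreeStarAlg n} (h : ProjSumRel n α a b) :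
    mk n α (star a) = mk n α (star b) := by
  cases h with
  | idem i => simpa [FreeStarAlg.star_letter] using mk_rel (ProjSumRel.idem (α := α) i)
  | sum =>
    rw [star_sum, FreeStarAlg.star_algebraMap, Complex.conj_ofReal]
    simpa only [FreeStarAlg.star_letter] using mk_rel (ProjSumRel.sum (n := n) (α := α))

/-- The involution of `P_{n,α}`, induced from the free `*`-algebra, as a ring homomorphism into
the opposite ring. -/
def starHom (n : ℕ) (α : ℝ) : ProjSumAlg n α →+* (ProjSumAlg n α)ᵐᵒᵖ :=
  RingQuot.lift
    ⟨((mk n α).toRingHom.op).comp (starRingEquiv (R := FreeStarAlg n)).toRingHom,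
      fun _ _ h => congrArg MulOpposite.op (mk_star_rel h)⟩

theorem starHom_mk {n : ℕ} {α : ℝ} (a : FreeStarAlg n) :
    starHom n α (mk n α a) = MulOpposite.op (mk n α (star a)) := by
  have h : mk n α a = RingQuot.mkRingHom (ProjSumRel n α) a :=
    DFunLike.congr_fun (RingQuot.mkAlgHom_coe ℂ (ProjSumRel n α)) a
  rw [h]
  exact RingQuot.lift_mkRingHom_apply _ _ _

instance (n : ℕ) (α : ℝ) : StarRing (ProjSumAlg n α) where
  star a := (starHom n α a).unop
  star_involutive a := by
    obtain ⟨a, rfl⟩ := mk_surjective n α a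
    simp [starHom_mk]
  star_mul a b := by simp
  star_add a b := by simp

theorem star_mk {n : ℕ} {α : ℝ} (a : FreeStarAlg n) : star (mk n α a) = mk n α (star a) :=
  congrArg MulOpposite.unop (starHom_mk a)

instance (n : ℕ) (α : ℝ) : StarModule ℂ (ProjSumAlg n α) where
  star_smul c a := by
    obtain ⟨a, rfl⟩ := mk_surjective n α a
    rw [← map_smul, star_mk, star_mk, ← map_smul, Algebra.smul_def, star_mul,
      FreeStarAlg.star_algebraMap, ← Algebra.commutes, ← Algebra.smul_def]
    rfl

theorem isStarProjection_gen {n : ℕ} {α : ℝ} (i : Fin n) :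
    IsStarProjection (gen i : ProjSumAlg n α) where
  isIdempotentElem := by
    have h := mk_rel (ProjSumRel.idem (α := α) i)
    rwa [map_mul] at h
  isSelfAdjoint := (star_mk _).trans (congrArg _ (FreeStarAlg.star_letter i))

theorem sum_gen (n : ℕ) (α : ℝ) :
    ∑ i, (gen i : ProjSumAlg n α) = algebraMap ℂ (ProjSumAlg n α) (α : ℂ) := by
  have h := mk_rel (ProjSumRel.sum (n := n) (α := α))
  rwa [map_sum, AlgHom.commutes] at h

end ProjSumAlg

/-! ### Systems of orthogonal projections -/

section Projections

variable {n : ℕ}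
  {H : Type u} [NormedAddCommGroup H] [InnerProductSpace ℂ H]
  {H' : Type v} [NormedAddCommGroup H'] [InnerProductSpace ℂ H']

/-- The operators `P_1, …, P_n` are irreducible: `0` and `H` are the only closed subspaces
invariant under all of them. -/
def IsIrreducibleFamily (P : Fin n → H →L[ℂ] H) : Prop :=
  ∀ K : ClosedSubmodule ℂ H, (∀ i, ∀ x ∈ K, P i x ∈ K) → K = ⊥ ∨ K = ⊤

/-- The families `P_1, …, P_n` on `H` and `P'_1, …, P'_n` on `H'` are unitarily equivalent. -/
def UnitarilyEquivalent (P : Fin n → H →L[ℂ] H) (P' : Fin n → H' →L[ℂ] H') : Prop :=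
  ∃ U : H ≃ₗᵢ[ℂ] H', ∀ i x, U (P i x) = P' i (U x)

end Projections

/-! ### Systems of subspaces -/

/-- A system `S = (H; H_1, …, H_n)` of `n` (closed) subspaces of a Hilbert space `H`. -/
abbrev SubspaceSystem (n : ℕ) (H : Type u) [NormedAddCommGroup H] [InnerProductSpace ℂ H] :
    Type u :=
  Fin n → ClosedSubmodule ℂ H

namespace SubspaceSystem

variable {n : ℕ}
  {H : Type u} [NormedAddCommGroup H] [InnerProductSpace ℂ H]
  {H' : Type v} [NormedAddCommGroup H'] [InnerProductSpace ℂ H']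

/-- `End(S) = {R ∈ B(H) | R(H_i) ⊆ H_i, i = 1, …, n}`. -/
def endomorphisms (S : SubspaceSystem n H) : Set (H →L[ℂ] H) :=
  {R | ∀ i, ∀ x ∈ S i, R x ∈ S i}

/-- `S` is transitive: `End(S) = ℂ I`. -/
def IsTransitive (S : SubspaceSystem n H) : Prop :=
  S.endomorphisms = Set.range fun c : ℂ => c • ContinuousLinearMap.id ℂ H

/-- `S ≅ S'`: there is a bounded linear bijection `R : H → H'` with bounded inverse such that
`R(H_i) = H'_i` for every `i`. -/
def Isomorphic (S : SubspaceSystem n H) (S' : SubspaceSystem n H') : Prop :=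
  ∃ R : H ≃L[ℂ] H', ∀ i, R '' (S i : Set H) = (S' i : Set H')

end SubspaceSystem

/-! ### `*`-representations of `P_{n,α}` -/

/-- A (unital) `*`-representation of `P_{n,α}` by bounded operators on the Hilbert space `H`. -/
abbrev ProjSumRep (n : ℕ) (α : ℝ) (H : Type u) [NormedAddCommGroup H] [InnerProductSpace ℂ H]
    [CompleteSpace H] : Type u :=
  ProjSumAlg n α →⋆ₐ[ℂ] (H →L[ℂ] H)

namespace ProjSumRep

variable {n : ℕ} {α : ℝ}
  {H : Type u} [NormedAddCommGroup H] [InnerProductSpace ℂ H] [CompleteSpace H]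

/-- The orthogonal projections `P_i = π(p_i)`. -/
def proj (π : ProjSumRep n α H) (i : Fin n) : H →L[ℂ] H := π (ProjSumAlg.gen i)

theorem isStarProjection_proj (π : ProjSumRep n α H) (i : Fin n) :
    IsStarProjection (π.proj i) :=
  (ProjSumAlg.isStarProjection_gen i).map π

/-- The system of subspaces `S_π = (H; P_1 H, …, P_n H)`. -/
def system (π : ProjSumRep n α H) : SubspaceSystem n H := fun i =>
  { toSubmodule := (π.proj i).range
    isClosed' :=
      ContinuousLinearMap.IsIdempotentElem.isClosed_range
        (π.isStarProjection_proj i).isIdempotentElem }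

end ProjSumRep

/-! ### The discrete spectrum -/

/-- The finite continued fractions
`c`, `(n-2) - 1/c`, `(n-2) - 1/((n-2) - 1/c)`, …. -/
def contFrac (n : ℕ) (c : ℝ) : ℕ → ℝ
  | 0 => c
  | k + 1 => ((n : ℝ) - 2) - 1 / contFrac n c k

/-- `Λ_n^0 = {0, 1 + 1/(n-1), 1 + 1/((n-2) - 1/(n-1)), …}`. -/
def Lambda0 (n : ℕ) : Set ℝ :=
  {0} ∪ Set.range fun k : ℕ => 1 + 1 / contFrac n ((n : ℝ) - 1) k

/-- `Λ_n^1 = {1, 1 + 1/(n-2), 1 + 1/((n-2) - 1/(n-2)), …}`. -/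
def Lambda1 (n : ℕ) : Set ℝ :=
  {1} ∪ Set.range fun k : ℕ => 1 + 1 / contFrac n ((n : ℝ) - 2) k

/-- The discrete spectrum: for `n = 2, 3` the (finite) set of all `α` for which `P_{n,α}` has a
nonzero `*`-representation, and `Λ_n^0 ∪ Λ_n^1 ∪ (n - Λ_n^1) ∪ (n - Λ_n^0)` for `n ≥ 4`. -/
def discreteSpectrum : ℕ → Set ℝ
  | 2 => {0, 1, 2}
  | 3 => {0, 1, 3 / 2, 2, 3}
  | n => Lambda0 n ∪ Lambda1 n ∪ (fun a => (n : ℝ) - a) '' Lambda1 n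
      ∪ (fun a => (n : ℝ) - a) '' Lambda0 n

end

/-!
The proof rests on two facts.

*Finite dimension.* For `α` in the discrete spectrum every irreducible representation of `P_{n,α}`
is finite-dimensional. A family of projections `P_i` on `E` with sum `α` gives the family `1 - P_i`
with sum `n - α`, and, on the space `relationSpace P` of relations `∑ x_i = 0` with `x_i ∈ P_i E`, a
family of projections with sum `α / (α - 1)`. Along both transforms finite-dimensional invariant
subspaces can be pulled back (`HasFiniteOrbits.of_sub`, `HasFiniteOrbits.of_div`). Iterating the composite
transform moves the points `1 + 1 / c` of `Λ_n^0` and `Λ_n^1` down to `0` and `1`, where the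
projections vanish, respectively are mutually orthogonal, and every vector visibly lies in a
finite-dimensional invariant subspace.

*Rigidity.* In finite dimension, let `R` map the range of each `P_i` into the range of `P'_i`, where
`∑ P_i = α`, `∑ P'_i = α'` and `α' ≤ α`. Comparing traces of `R* P'_i R` and `R P_i R*` shows
`P'_i R = R P_i` (`intertwines_of_apply_apply`). With `P' = P`, Schur's lemma makes every
endomorphism of an irreducible system scalar. With `R` invertible, `R* R` is scalar by Schur's lemma
and `R` is a multiple of a unitary equivalence; the two representations are interchanged if
`α < α'`.
-/

/-! ### Families with finite-dimensional invariant subspaces -/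

/-- Every vector lies in a finite-dimensional invariant subspace, for every family of `n`
orthogonal projections with sum `α` on a complex inner product space. Completeness is not required,
so that the property can be transported through `relationSpace` as a mere linear subspace. -/
def HasFiniteOrbits (n : ℕ) (α : ℝ) : Prop :=
  ∀ (E : Type u) [NormedAddCommGroup E] [InnerProductSpace ℂ E] (P : Fin n → E →ₗ[ℂ] E),
    (∀ i, (P i).IsSymmetricProjection) → (∀ x, ∑ i, P i x = (α : ℂ) • x) →
    ∀ v, ∃ W : Submodule ℂ E, FiniteDimensional ℂ W ∧ v ∈ W ∧ ∀ i, ∀ x ∈ W, P i x ∈ W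

theorem LinearMap.IsSymmetricProjection.apply_apply {E : Type*} [NormedAddCommGroup E]
    [InnerProductSpace ℂ E] {P : E →ₗ[ℂ] E} (h : P.IsSymmetricProjection) (x : E) :
    P (P x) = P x :=
  LinearMap.congr_fun h.isIdempotentElem x

theorem LinearMap.IsSymmetricProjection.inner_apply_self {E : Type*} [NormedAddCommGroup E]
    [InnerProductSpace ℂ E] {P : E →ₗ[ℂ] E} (h : P.IsSymmetricProjection) (x : E) :
    inner ℂ x (P x) = ((‖P x‖ ^ 2 : ℝ) : ℂ) := by
  rw [← h.apply_apply, ← h.isSymmetric x (P x), h.apply_apply, inner_self_eq_norm_sq_to_K]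
  simp

theorem sum_norm_sq_apply {n : ℕ} {α : ℝ} {E : Type*} [NormedAddCommGroup E]
    [InnerProductSpace ℂ E] {P : Fin n → E →ₗ[ℂ] E} (h : ∀ i, (P i).IsSymmetricProjection)
    (hs : ∀ x, ∑ i, P i x = (α : ℂ) • x) (x : E) : ∑ i, ‖P i x‖ ^ 2 = α * ‖x‖ ^ 2 := by
  have := congrArg (inner ℂ x) (hs x)
  simp only [inner_sum, (h _).inner_apply_self, inner_smul_right,
    inner_self_eq_norm_sq_to_K] at this
  apply Complex.ofReal_injective
  push_cast at this ⊢
  exact this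

/-- Positivity forces projections with sum `0` to vanish. -/
theorem hasFiniteOrbits_zero (n : ℕ) : HasFiniteOrbits.{u} n 0 := by
  intro E _ _ P h hs v
  have h0 (i : Fin n) (x : E) : P i x = 0 := by
    have := sum_norm_sq_apply h hs x
    rw [zero_mul, Finset.sum_eq_zero_iff_of_nonneg fun _ _ => by positivity] at this
    simpa using this i (Finset.mem_univ i)
  exact ⟨Submodule.span ℂ {v}, inferInstance, Submodule.mem_span_singleton_self v,
    fun i x _ => by simp [h0]⟩

/-- Positivity forces projections with sum `1` to be mutually orthogonal, so the span of
`P₁ v, …, Pₙ v` is invariant. -/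
theorem hasFiniteOrbits_one (n : ℕ) : HasFiniteOrbits.{u} n 1 := by
  intro E _ _ P h hs v
  have h0 (i j : Fin n) (hij : i ≠ j) (x : E) : P i (P j x) = 0 := by
    have := sum_norm_sq_apply h hs (P j x)
    rw [← Finset.add_sum_erase _ _ (Finset.mem_univ j), (h j).apply_apply, one_mul,
      add_eq_left, Finset.sum_eq_zero_iff_of_nonneg fun _ _ => by positivity] at this
    simpa using this i (Finset.mem_erase.2 ⟨hij, Finset.mem_univ i⟩)
  refine ⟨Submodule.span ℂ (Set.range fun i => P i v),
    FiniteDimensional.span_of_finite ℂ (Set.finite_range _), ?_, fun i x hx => ?_⟩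
  · have := hs v
    rw [Complex.ofReal_one, one_smul] at this
    have hmem (i : Fin n) : P i v ∈ Submodule.span ℂ (Set.range fun i => P i v) :=
      Submodule.subset_span ⟨i, rfl⟩
    have hsum := Submodule.sum_mem _ (t := Finset.univ) fun i _ => hmem i
    rwa [this] at hsum
  · induction hx using Submodule.span_induction with
    | mem x hx =>
      obtain ⟨j, rfl⟩ := hx
      by_cases hij : i = j
      · subst hij
        change P i (P i v) ∈ _
        rw [(h i).apply_apply]
        exact Submodule.subset_span (Set.mem_range_self i)
      · simp [h0 i j hij]
    | zero => simp
    | add x y _ _ hx hy => rw [map_add]; exact add_mem hx hy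
    | smul c x _ hx => rw [map_smul]; exact Submodule.smul_mem _ c hx

/-- The families `P_i` (with sum `α`) and `1 - P_i` (with sum `n - α`) have the same invariant
subspaces. -/
theorem HasFiniteOrbits.of_sub {n : ℕ} {α : ℝ} (hα : HasFiniteOrbits.{u} n (n - α)) :
    HasFiniteOrbits.{u} n α := by
  intro E _ _ P h hs v
  obtain ⟨W, hW, hv, hinv⟩ := hα E (fun i => LinearMap.id - P i)
    (fun i => ⟨(h i).isIdempotentElem.one_sub, LinearMap.IsSymmetric.id.sub (h i).isSymmetric⟩)
    (fun x => by simp [hs, sub_smul, Nat.cast_smul_eq_nsmul]) v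
  refine ⟨W, hW, hv, fun i x hx => ?_⟩
  have := sub_mem hx (hinv i x hx)
  simpa using this

/-! ### The Coxeter transform -/

/-- The space of linear relations `∑ x_i = 0` with `x_i ∈ P_i E`, inside the `ℓ²` sum of `n` copies
of `E`: the kernel of the summation map `⨁ P_i E → E`. -/
def relationSpace {n : ℕ} {E : Type*} [NormedAddCommGroup E] [InnerProductSpace ℂ E]
    (P : Fin n → E →ₗ[ℂ] E) : Submodule ℂ (PiLp 2 fun _ : Fin n => E) where
  carrier := {x | (∀ i, P i (x i) = x i) ∧ ∑ i, x i = 0}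
  add_mem' hx hy := ⟨fun i => by simp [hx.1 i, hy.1 i], by
    simp [Finset.sum_add_distrib, hx.2, hy.2]⟩
  zero_mem' := by simp
  smul_mem' c x hx := ⟨fun i => by simp [hx.1 i], by simp [← Finset.smul_sum, hx.2]⟩

/-- The vector of `relationSpace P` with `j`-th entry `P_j v` and `i`-th entry
`-(α - 1)⁻¹ P_i P_j v` for `i ≠ j`, provided that `α ≠ 1`; for `α = 1` it is the junk value `0`. As a
function of `v` it is `α / (α - 1)` times the adjoint of the `j`-th coordinate
`relationSpace P → E`, see `inner_relationVector`. -/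
noncomputable def relationVector {n : ℕ} {α : ℝ} {E : Type*} [NormedAddCommGroup E]
    [InnerProductSpace ℂ E] {P : Fin n → E →ₗ[ℂ] E} (h : ∀ i, (P i).IsSymmetricProjection)
    (hs : ∀ x, ∑ i, P i x = (α : ℂ) • x) (j : Fin n) : E →ₗ[ℂ] relationSpace P where
  toFun v := ⟨WithLp.toLp 2 fun i =>
      ((α : ℂ) - 1)⁻¹ • (Pi.single (M := fun _ => E) j ((α : ℂ) • P j v) i - P i (P j v)),
    fun i => by
      rcases eq_or_ne i j with rfl | hij
      · simp [(h _).apply_apply]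
      · simp [hij, (h _).apply_apply],
    by simp [← Finset.smul_sum, Finset.sum_sub_distrib, hs]⟩
  map_add' v w := by
    ext i
    rcases eq_or_ne i j with rfl | hij
    · simp; module
    · simp [hij]; module
  map_smul' c v := by
    ext i
    rcases eq_or_ne i j with rfl | hij
    · simp; module
    · simp [hij]; module

section

variable {n : ℕ} {α : ℝ} {E : Type*} [NormedAddCommGroup E]
    [InnerProductSpace ℂ E] {P : Fin n → E →ₗ[ℂ] E} (h : ∀ i, (P i).IsSymmetricProjection)
    (hs : ∀ x, ∑ i, P i x = (α : ℂ) • x)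

theorem relationVector_apply_self (hα : α ≠ 1) (j : Fin n) (v : E) :
    (relationVector h hs j v : PiLp 2 fun _ : Fin n => E) j = P j v := by
  have : (α : ℂ) - 1 ≠ 0 := sub_ne_zero.2 (mod_cast hα)
  simp only [relationVector, LinearMap.coe_mk, AddHom.coe_mk, Pi.single_eq_same,
    (h _).apply_apply]
  match_scalars
  field_simp

theorem relationVector_apply_of_ne {i j : Fin n} (hij : i ≠ j) (v : E) :
    (relationVector h hs j v : PiLp 2 fun _ : Fin n => E) i
      = -((α : ℂ) - 1)⁻¹ • P i (P j v) := by
  simp [relationVector, hij]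

theorem inner_relationVector (j : Fin n) (v : E) (y : relationSpace P) :
    inner ℂ (relationVector h hs j v) y
      = ((α : ℂ) - 1)⁻¹ * α * inner ℂ v ((y : PiLp 2 fun _ : Fin n => E) j) := by
  have h1 (i : Fin n) : inner ℂ (P i (P j v)) ((y : PiLp 2 fun _ : Fin n => E) i)
      = inner ℂ (P j v) ((y : PiLp 2 fun _ : Fin n => E) i) := by
    rw [(h i).isSymmetric, y.2.1 i]
  have h2 (i : Fin n) :
      inner ℂ (Pi.single (M := fun _ => E) j ((α : ℂ) • P j v) i)
        ((y : PiLp 2 fun _ : Fin n => E) i)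
      = if i = j then (α : ℂ) * inner ℂ v ((y : PiLp 2 fun _ : Fin n => E) j) else 0 := by
    rcases eq_or_ne i j with rfl | hij
    · rw [Pi.single_eq_same, inner_smul_left, (h i).isSymmetric, y.2.1 i]
      simp
    · simp [hij]
  simp only [Submodule.coe_inner, PiLp.inner_apply, relationVector, LinearMap.coe_mk,
    AddHom.coe_mk, inner_smul_left, inner_sub_left, h1, h2, ← Finset.mul_sum,
    Finset.sum_sub_distrib, ← inner_sum, y.2.2]
  simp [mul_assoc]

/-- The `j`-th projection of the Coxeter transform of the family `P`: it sends a relation `x` to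
the relation built from its `j`-th entry. These projections have sum `α / (α - 1)`. -/
noncomputable def relationProj (j : Fin n) : relationSpace P →ₗ[ℂ] relationSpace P :=
  relationVector h hs j ∘ₗ
    LinearMap.proj j ∘ₗ (WithLp.linearEquiv 2 ℂ (Fin n → E)).toLinearMap ∘ₗ
      (relationSpace P).subtype

theorem relationProj_apply (j : Fin n) (x : relationSpace P) :
    relationProj h hs j x
      = relationVector h hs j ((x : PiLp 2 fun _ : Fin n => E) j) := rfl

theorem isSymmetricProjection_relationProj (hα : α ≠ 1) (j : Fin n) :
    (relationProj h hs j).IsSymmetricProjection where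
  isIdempotentElem := by
    ext1 x
    rw [Module.End.mul_apply, relationProj_apply, relationProj_apply,
      relationVector_apply_self h hs hα, x.2.1 j]
  isSymmetric x y := by
    rw [← inner_conj_symm x, relationProj_apply, relationProj_apply, inner_relationVector,
      inner_relationVector]
    simp

theorem sum_relationProj (x : relationSpace P) :
    ∑ j, relationProj h hs j x = ((α / (α - 1) : ℝ) : ℂ) • x := by
  refine ext_inner_right ℂ fun y => ?_
  simp only [sum_inner, relationProj_apply, inner_relationVector, ← Finset.mul_sum]
  rw [Submodule.coe_inner, Submodule.coe_smul, inner_smul_left, PiLp.inner_apply,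
    Complex.conj_ofReal]
  push_cast
  ring

end

/-- Finite-dimensional invariant subspaces can be pulled back along the Coxeter transform: if
`W'` is invariant under the projections of `relationSpace P`, then the sum of its images
under the coordinate maps is invariant under the `P_k`, because for `k ≠ j` the vector `P_k y_j` is a multiple of
the `k`-th entry of `relationProj h hs j y`. -/
theorem HasFiniteOrbits.of_div {n : ℕ} {α : ℝ} (h0 : α ≠ 0) (h1 : α ≠ 1)
    (hα : HasFiniteOrbits.{u} n (α / (α - 1))) : HasFiniteOrbits.{u} n α := by
  intro E _ _ P h hs v
  have h1' : (α : ℂ) - 1 ≠ 0 := sub_ne_zero.2 (mod_cast h1)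
  choose W hW hv hinv using fun j => hα (relationSpace P) (relationProj h hs)
    (isSymmetricProjection_relationProj h hs h1) (sum_relationProj h hs)
    (relationVector h hs j v)
  let c (j : Fin n) : relationSpace P →ₗ[ℂ] E := LinearMap.proj j ∘ₗ
    (WithLp.linearEquiv 2 ℂ (Fin n → E)).toLinearMap ∘ₗ (relationSpace P).subtype
  -- `W'` contains `relationVector h hs j v` for all `j`; these suffice since `v = α⁻¹ ∑ P_j v`.
  let W' := ⨆ k, W k
  have hW' : FiniteDimensional ℂ W' := inferInstance
  have hinv' (j : Fin n) : W' ≤ W'.comap (relationProj h hs j) :=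
    iSup_le fun k x hx => Submodule.mem_iSup_of_mem k (hinv k j x hx)
  refine ⟨⨆ j, W'.map (c j), inferInstance, ?_, fun k => ?_⟩
  · have hj (j : Fin n) : P j v ∈ ⨆ j, W'.map (c j) :=
      Submodule.mem_iSup_of_mem j ⟨_, Submodule.mem_iSup_of_mem j (hv j),
        relationVector_apply_self h hs h1 j v⟩
    have := Submodule.smul_mem _ (α : ℂ)⁻¹ (Submodule.sum_mem _ (t := Finset.univ) fun j _ => hj j)
    rwa [hs, smul_smul, inv_mul_cancel₀ (mod_cast h0), one_smul] at this
  · change ⨆ j, W'.map (c j) ≤ (⨆ j, W'.map (c j)).comap (P k)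
    refine iSup_le fun j => ?_
    rintro _ ⟨y, hy, rfl⟩
    change P k (y.1 j) ∈ ⨆ j, W'.map (c j)
    rcases eq_or_ne k j with rfl | hkj
    · rw [y.2.1 k]
      exact Submodule.mem_iSup_of_mem k ⟨y, hy, rfl⟩
    · have : P k (y.1 j) = -((α : ℂ) - 1) • c k (relationProj h hs j y) := by
        change _ = _ • (relationVector h hs j (y.1 j)).1 k
        rw [relationVector_apply_of_ne h hs hkj, y.2.1 j]
        match_scalars
        field_simp
      rw [this]
      exact Submodule.smul_mem _ _ (Submodule.mem_iSup_of_mem k ⟨_, hinv' j hy, rfl⟩)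

/-! ### The discrete spectrum -/

theorem HasFiniteOrbits.reflect {n : ℕ} {α : ℝ} (hα : HasFiniteOrbits.{u} n α) :
    HasFiniteOrbits.{u} n (n - α) :=
  .of_sub (by rwa [sub_sub_cancel])

/-- The composite of the transforms `α ↦ n - α` and `α ↦ α / (α - 1)` is the map
`β ↦ 1 + 1 / (n - 1 - β)` generating the discrete spectrum from `0` and `1`. -/
theorem HasFiniteOrbits.one_add_one_div {n : ℕ} {c : ℝ} (hc : 0 < c)
    (h : HasFiniteOrbits.{u} n (n - 1 - c)) : HasFiniteOrbits.{u} n (1 + 1 / c) := by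
  have : 0 < 1 / c := by positivity
  refine .of_div (by positivity) (by linarith) (.of_sub ?_)
  convert h using 1
  field_simp
  ring

/-- In particular the denominators defining `discreteSpectrum n` for `n ≥ 4` do not vanish. -/
theorem one_le_contFrac {n : ℕ} (hn : 4 ≤ n) {c : ℝ} (hc : 1 ≤ c) (k : ℕ) :
    1 ≤ contFrac n c k := by
  induction k with
  | zero => exact hc
  | succ k ih =>
    have h4 : (4 : ℝ) ≤ n := mod_cast hn
    have : 1 / contFrac n c k ≤ 1 := (div_le_one (by linarith)).2 ih
    simp only [contFrac]
    linarith

theorem hasFiniteOrbits_contFrac {n : ℕ} (hn : 4 ≤ n) {β : ℝ} (hβ : β ≤ 1)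
    (h : HasFiniteOrbits.{u} n β) (k : ℕ) :
    HasFiniteOrbits.{u} n (1 + 1 / contFrac n (n - 1 - β) k) := by
  have h4 : (4 : ℝ) ≤ n := mod_cast hn
  have hpos k : 0 < contFrac n (n - 1 - β) k :=
    one_pos.trans_le (one_le_contFrac hn (by linarith) k)
  induction k with
  | zero => exact .one_add_one_div (hpos 0) (by simpa [contFrac] using h)
  | succ k ih =>
    refine .one_add_one_div (hpos (k + 1)) ?_
    convert ih using 1
    simp only [contFrac]
    ring

theorem hasFiniteOrbits_of_mem_discreteSpectrum {n : ℕ} (hn : 2 ≤ n) {α : ℝ}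
    (hα : α ∈ discreteSpectrum n) : HasFiniteOrbits.{u} n α := by
  have h0 : HasFiniteOrbits.{u} n 0 := hasFiniteOrbits_zero n
  have h1 : HasFiniteOrbits.{u} n 1 := hasFiniteOrbits_one n
  match n, hn, hα with
  | 2, _, hα =>
    rcases hα with rfl | rfl | rfl
    · exact h0
    · exact h1
    · simpa using h0.reflect
  | 3, _, hα =>
    have h3 : HasFiniteOrbits.{u} 3 3 := by simpa using h0.reflect
    rcases hα with rfl | rfl | rfl | rfl | rfl
    · exact h0
    · exact h1
    · exact .of_div (by norm_num) (by norm_num) (by norm_num; exact h3)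
    · convert h1.reflect using 1
      norm_num
    · exact h3
  | m + 4, _, hα =>
    have hΛ0 : ∀ β ∈ Lambda0 (m + 4), HasFiniteOrbits.{u} (m + 4) β := by
      rintro β (rfl | ⟨k, rfl⟩)
      · exact h0
      · simpa using hasFiniteOrbits_contFrac (by omega) zero_le_one h0 k
    have hΛ1 : ∀ β ∈ Lambda1 (m + 4), HasFiniteOrbits.{u} (m + 4) β := by
      rintro β (rfl | ⟨k, rfl⟩)
      · exact h1
      · have := hasFiniteOrbits_contFrac (by omega) le_rfl h1 k
        rwa [sub_sub, one_add_one_eq_two] at this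
    rcases hα with ((hα | hα) | ⟨β, hβ, rfl⟩) | ⟨β, hβ, rfl⟩
    · exact hΛ0 α hα
    · exact hΛ1 α hα
    · exact (hΛ1 β hβ).reflect
    · exact (hΛ0 β hβ).reflect

/-! ### Irreducible families -/

section

variable {n : ℕ} {H : Type u} [NormedAddCommGroup H] [InnerProductSpace ℂ H]

theorem IsIrreducibleFamily.eq_bot_or_eq_top {P : Fin n → H →L[ℂ] H}
    (hP : IsIrreducibleFamily P) (W : Submodule ℂ H) [FiniteDimensional ℂ W]
    (hW : ∀ i, ∀ x ∈ W, P i x ∈ W) : W = ⊥ ∨ W = ⊤ :=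
  (hP ⟨W, W.closed_of_finiteDimensional⟩ hW).imp (congrArg ClosedSubmodule.toSubmodule)
    (congrArg ClosedSubmodule.toSubmodule)

/-- Schur's lemma. -/
theorem IsIrreducibleFamily.exists_eq_smul [FiniteDimensional ℂ H] {P : Fin n → H →L[ℂ] H}
    (hP : IsIrreducibleFamily P) (R : H →L[ℂ] H) (hR : ∀ i x, R (P i x) = P i (R x)) :
    ∃ c : ℂ, R = c • ContinuousLinearMap.id ℂ H := by
  rcases subsingleton_or_nontrivial H with hH | hH
  · exact ⟨0, ContinuousLinearMap.ext fun _ => Subsingleton.elim _ _⟩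
  obtain ⟨c, hc⟩ := Module.End.exists_eigenvalue (R : H →ₗ[ℂ] H)
  refine ⟨c, ContinuousLinearMap.ext fun x => ?_⟩
  have htop := (hP.eq_bot_or_eq_top (Module.End.eigenspace (R : H →ₗ[ℂ] H) c)
    fun i x hx => ?_).resolve_left hc
  · have : x ∈ Module.End.eigenspace (R : H →ₗ[ℂ] H) c := htop ▸ Submodule.mem_top
    simpa [Module.End.mem_eigenspace_iff] using this
  · rw [Module.End.mem_eigenspace_iff] at hx ⊢
    simp only [ContinuousLinearMap.coe_coe] at hx ⊢
    rw [hR, hx, map_smul]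

theorem UnitarilyEquivalent.symm {H' : Type v} [NormedAddCommGroup H']
    [InnerProductSpace ℂ H'] {P : Fin n → H →L[ℂ] H} {P' : Fin n → H' →L[ℂ] H'}
    (h : UnitarilyEquivalent P P') : UnitarilyEquivalent P' P := by
  obtain ⟨U, hU⟩ := h
  exact ⟨U.symm, fun i x => U.injective (by simp [hU])⟩

end

/-! ### Operators between systems of subspaces -/

section

open ContinuousLinearMap

variable {n : ℕ} {α α' : ℝ} {H : Type u} [NormedAddCommGroup H] [InnerProductSpace ℂ H]
  [CompleteSpace H] {H' : Type v} [NormedAddCommGroup H'] [InnerProductSpace ℂ H']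
  [CompleteSpace H']

theorem trace_adjoint_comp_self [FiniteDimensional ℂ H] (X : H →L[ℂ] H') :
    LinearMap.trace ℂ H (adjoint X ∘L X : H →L[ℂ] H)
      = ((∑ k, ‖X (stdOrthonormalBasis ℂ H k)‖ ^ 2 : ℝ) : ℂ) := by
  rw [LinearMap.trace_eq_sum_inner _ (stdOrthonormalBasis ℂ H)]
  simp [adjoint_inner_right, inner_self_eq_norm_sq_to_K]

/-- An operator mapping each range of `P_i` into the range of `P'_i` intertwines the projections if
`∑ P'_i = α'` and `∑ P_i = α` with `α' ≤ α`. Indeed `X_i = P'_i R (1 - P_i)` satisfies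
`∑ tr (X_i* X_i) = (α' - α) tr (R* R) ≤ 0`, so every `X_i` vanishes. -/
theorem intertwines_of_apply_apply [FiniteDimensional ℂ H] {P : Fin n → H →L[ℂ] H}
    {P' : Fin n → H' →L[ℂ] H'} (hP : ∀ i, IsStarProjection (P i))
    (hP' : ∀ i, IsStarProjection (P' i)) (hs : ∑ i, P i = (α : ℂ) • .id ℂ H)
    (hs' : ∑ i, P' i = (α' : ℂ) • .id ℂ H') (hα : α' ≤ α) (R : H →L[ℂ] H')
    (hR : ∀ i x, P' i (R (P i x)) = R (P i x)) (i : Fin n) (x : H) :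
    R (P i x) = P' i (R x) := by
  -- `τ` is the trace on bounded operators; only its cyclicity and positivity are used.
  let τ : (H →L[ℂ] H) →ₗ[ℂ] ℂ := LinearMap.trace ℂ H ∘ₗ ContinuousLinearMap.coeLM ℂ
  have τ_comm (A B : H →L[ℂ] H) : τ (A * B) = τ (B * A) := LinearMap.trace_mul_comm ℂ _ _
  let X (i : Fin n) : H →L[ℂ] H' := P' i ∘L R ∘L (1 - P i)
  have hX (i : Fin n) : τ (adjoint (X i) ∘L X i)
      = τ (adjoint R ∘L P' i ∘L R) - τ (adjoint R ∘L R ∘L P i) := by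
    have hadj : adjoint (X i) = (1 - P i) ∘L adjoint R ∘L P' i := by
      have h1 : adjoint (P i) = P i := (hP i).isSelfAdjoint.adjoint_eq
      have h2 : adjoint (P' i) = P' i := (hP' i).isSelfAdjoint.adjoint_eq
      have h3 : adjoint (1 : H →L[ℂ] H) = 1 := star_one _
      simp only [X, adjoint_comp, map_sub, h1, h2, h3, comp_assoc]
    have e1 : adjoint (X i) ∘L X i = (1 - P i) * ((adjoint R ∘L P' i ∘L R) * (1 - P i)) := by
      ext y
      rw [hadj]
      have := DFunLike.congr_fun (hP' i).isIdempotentElem (R ((1 - P i) y))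
      change P' i (P' i _) = P' i _ at this
      change (1 - P i) (adjoint R (P' i (P' i (R ((1 - P i) y))))) = _
      rw [this]
      rfl
    have e2 : (adjoint R ∘L P' i ∘L R) * P i = adjoint R ∘L R ∘L P i := by
      ext y
      exact congrArg (adjoint R) (hR i y)
    rw [e1, τ_comm, mul_assoc, (hP i).isIdempotentElem.one_sub.eq, mul_sub, mul_one, e2, map_sub]
  have hsum : ∑ i, τ (adjoint (X i) ∘L X i) = ((α' : ℂ) - α) * τ (adjoint R ∘L R) := by
    simp only [hX, Finset.sum_sub_distrib, ← map_sum]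
    have e1 : ∑ i, adjoint R ∘L P' i ∘L R = (α' : ℂ) • (adjoint R ∘L R) := by
      ext y
      have := DFunLike.congr_fun hs' (R y)
      simp only [sum_apply, smul_apply, id_apply] at this
      simp [← map_sum, this]
    have e2 : ∑ i, adjoint R ∘L R ∘L P i = (α : ℂ) • (adjoint R ∘L R) := by
      ext y
      have := DFunLike.congr_fun hs y
      simp only [sum_apply, smul_apply, id_apply] at this
      simp [← map_sum, this]
    rw [e1, e2, map_smul, map_smul, sub_mul, smul_eq_mul, smul_eq_mul]
  have hτ {Y : H →L[ℂ] H'} : τ (adjoint Y ∘L Y) = _ := trace_adjoint_comp_self Y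
  simp only [hτ] at hsum
  norm_cast at hsum
  have hle : ∑ i, ∑ k, ‖X i (stdOrthonormalBasis ℂ H k)‖ ^ 2 ≤ 0 := by
    rw [hsum]
    exact mul_nonpos_of_nonpos_of_nonneg (by linarith) (by positivity)
  have h0 := hle.antisymm (by positivity)
  rw [Finset.sum_eq_zero_iff_of_nonneg fun _ _ => by positivity] at h0
  have h1 := h0 i (Finset.mem_univ i)
  rw [Finset.sum_eq_zero_iff_of_nonneg fun _ _ => by positivity] at h1
  have h2 : (X i : H →ₗ[ℂ] H') = 0 := (stdOrthonormalBasis ℂ H).toBasis.ext fun k => by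
    simpa using h1 k (Finset.mem_univ k)
  have h3 : P' i (R (x - P i x)) = 0 := LinearMap.congr_fun h2 x
  rw [map_sub, map_sub, hR, sub_eq_zero] at h3
  exact h3.symm

/-- By Schur's lemma `R* R` is a scalar, so an invertible intertwiner `R` is a multiple of a unitary
one. -/
theorem unitarilyEquivalent_of_intertwines [FiniteDimensional ℂ H] {P : Fin n → H →L[ℂ] H}
    {P' : Fin n → H' →L[ℂ] H'} (hP : ∀ i, IsStarProjection (P i))
    (hP' : ∀ i, IsStarProjection (P' i)) (hirr : IsIrreducibleFamily P) (R : H ≃L[ℂ] H')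
    (hR : ∀ i x, R (P i x) = P' i (R x)) : UnitarilyEquivalent P P' := by
  obtain ⟨A, hA⟩ : ∃ A : H →L[ℂ] H, ∀ x y, inner ℂ x (A y) = inner ℂ (R x) (R y) :=
    ⟨ContinuousLinearMap.adjoint (R : H →L[ℂ] H') ∘L R, fun x y =>
      ContinuousLinearMap.adjoint_inner_right (R : H →L[ℂ] H') x (R y)⟩
  have hsym (i : Fin n) (x y : H) : inner ℂ (P i x) y = inner ℂ x (P i y) :=
    (hP i).isSelfAdjoint.isSymmetric x y
  have hsym' (i : Fin n) (x y : H') : inner ℂ (P' i x) y = inner ℂ x (P' i y) :=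
    (hP' i).isSelfAdjoint.isSymmetric x y
  obtain ⟨c, hc⟩ := hirr.exists_eq_smul A fun i y => ext_inner_left ℂ fun x => by
    rw [hA, ← hsym, hA, hR, hR, hsym']
  have hcR (x : H) : ((‖R x‖ ^ 2 : ℝ) : ℂ) = c * ((‖x‖ ^ 2 : ℝ) : ℂ) := by
    have := hA x x
    rw [hc, smul_apply, ContinuousLinearMap.id_apply, inner_smul_right,
      inner_self_eq_norm_sq_to_K, inner_self_eq_norm_sq_to_K] at this
    push_cast
    exact this.symm
  rcases subsingleton_or_nontrivial H with hH | hH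
  · refine ⟨⟨R.toLinearEquiv, fun x => ?_⟩, hR⟩
    simp [Subsingleton.elim x 0]
  obtain ⟨x₀, hx₀⟩ := exists_ne (0 : H)
  obtain ⟨r, hr, hrR⟩ : ∃ r : ℝ, 0 < r ∧ ∀ x, ‖R x‖ = r * ‖x‖ := by
    have hpos : 0 < ‖x₀‖ := norm_pos_iff.2 hx₀
    have hRpos : 0 < ‖R x₀‖ := norm_pos_iff.2 (by simpa using hx₀)
    refine ⟨‖R x₀‖ / ‖x₀‖, by positivity, fun x => ?_⟩
    have h1 := hcR x₀
    have h2 := hcR x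
    have hne : ((‖x₀‖ ^ 2 : ℝ) : ℂ) ≠ 0 := by exact_mod_cast (by positivity : ‖x₀‖ ^ 2 ≠ 0)
    rw [← div_eq_iff hne] at h1
    rw [← h1] at h2
    rw [← Complex.ofReal_div, ← Complex.ofReal_mul, Complex.ofReal_inj] at h2
    rw [← sq_eq_sq₀ (by positivity) (by positivity), h2]
    field_simp
  have hr' : (r : ℂ)⁻¹ ≠ 0 := inv_ne_zero (mod_cast hr.ne')
  refine ⟨⟨R.toLinearEquiv.trans (LinearEquiv.smulOfNeZero ℂ H' _ hr'), fun x => ?_⟩,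
    fun i x => ?_⟩
  · change ‖(r : ℂ)⁻¹ • R x‖ = _
    rw [norm_smul, hrR, norm_inv, Complex.norm_real, Real.norm_of_nonneg hr.le,
      inv_mul_cancel_left₀ hr.ne']
  · change (r : ℂ)⁻¹ • R (P i x) = P' i ((r : ℂ)⁻¹ • R x)
    rw [hR, map_smul]

end

/-! ### Representations on the discrete spectrum -/

section

variable {n : ℕ} {α α' : ℝ} {H : Type u} [NormedAddCommGroup H] [InnerProductSpace ℂ H]
  [CompleteSpace H] {H' : Type v} [NormedAddCommGroup H'] [InnerProductSpace ℂ H']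
  [CompleteSpace H']

theorem ProjSumRep.sum_proj (π : ProjSumRep n α H) :
    ∑ i, π.proj i = (α : ℂ) • ContinuousLinearMap.id ℂ H := by
  have := congrArg π (ProjSumAlg.sum_gen n α)
  rwa [map_sum, AlgHomClass.commutes, Algebra.algebraMap_eq_smul_one] at this

theorem ProjSumRep.mem_system_iff (π : ProjSumRep n α H) (i : Fin n) (x : H) :
    x ∈ π.system i ↔ π.proj i x = x :=
  ⟨by rintro ⟨y, rfl⟩; exact DFunLike.congr_fun (π.isStarProjection_proj i).isIdempotentElem y,
    fun h => ⟨x, h⟩⟩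

theorem HasFiniteOrbits.finiteDimensional (hα : HasFiniteOrbits.{u} n α) (π : ProjSumRep n α H)
    (hπ : IsIrreducibleFamily π.proj) : FiniteDimensional ℂ H := by
  rcases subsingleton_or_nontrivial H with hH | hH
  · infer_instance
  obtain ⟨v, hv⟩ := exists_ne (0 : H)
  obtain ⟨W, hW, hvW, hinv⟩ := hα H (fun i => (π.proj i : H →ₗ[ℂ] H))
    (fun i => ContinuousLinearMap.isStarProjection_iff_isSymmetricProjection.1
      (π.isStarProjection_proj i))
    (fun x => by simpa using DFunLike.congr_fun π.sum_proj x) v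
  rcases hπ.eq_bot_or_eq_top W hinv with rfl | rfl
  · exact absurd hvW hv
  · exact Module.finite_def.2 (Module.Finite.iff_fg.1 hW)

theorem ProjSumRep.isTransitive_system (π : ProjSumRep n α H) [FiniteDimensional ℂ H]
    (hπ : IsIrreducibleFamily π.proj) : π.system.IsTransitive := by
  refine Set.Subset.antisymm (fun R hR => ?_) ?_
  · have hR' (i : Fin n) (x : H) : π.proj i (R (π.proj i x)) = R (π.proj i x) :=
      (π.mem_system_iff i _).1 (hR i _ ⟨x, rfl⟩)
    obtain ⟨c, hc⟩ := hπ.exists_eq_smul R (intertwines_of_apply_apply π.isStarProjection_proj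
      π.isStarProjection_proj π.sum_proj π.sum_proj le_rfl R hR')
    exact ⟨c, hc.symm⟩
  · rintro _ ⟨c, rfl⟩ i x hx
    exact (π.system i).smul_mem c hx

theorem ProjSumRep.unitarilyEquivalent_of_image_system_eq [FiniteDimensional ℂ H]
    (π : ProjSumRep n α H) (π' : ProjSumRep n α' H') (hα : α' ≤ α)
    (hπ : IsIrreducibleFamily π.proj) (R : H ≃L[ℂ] H')
    (hR : ∀ i, R '' (π.system i : Set H) = (π'.system i : Set H')) :
    UnitarilyEquivalent π.proj π'.proj := by
  refine unitarilyEquivalent_of_intertwines π.isStarProjection_proj π'.isStarProjection_proj hπ R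
    (intertwines_of_apply_apply π.isStarProjection_proj π'.isStarProjection_proj π.sum_proj
      π'.sum_proj hα (R : H →L[ℂ] H') fun i x => (π'.mem_system_iff i _).1 ?_)
  exact (hR i).subset ⟨_, ⟨x, rfl⟩, rfl⟩

end

theorem theorem3 (n : ℕ) (hn : 2 ≤ n) :
    (∀ α ∈ discreteSpectrum n,
      ∀ (H : Type u) [NormedAddCommGroup H] [InnerProductSpace ℂ H] [CompleteSpace H]
        (π : ProjSumRep n α H),
        IsIrreducibleFamily π.proj → π.system.IsTransitive) ∧
    (∀ α ∈ discreteSpectrum n, ∀ α' ∈ discreteSpectrum n,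
      ∀ (H : Type u) [NormedAddCommGroup H] [InnerProductSpace ℂ H] [CompleteSpace H]
        (H' : Type v) [NormedAddCommGroup H'] [InnerProductSpace ℂ H'] [CompleteSpace H']
        (π : ProjSumRep n α H) (π' : ProjSumRep n α' H'),
        IsIrreducibleFamily π.proj → IsIrreducibleFamily π'.proj →
        ¬ UnitarilyEquivalent π.proj π'.proj →
        ¬ π.system.Isomorphic π'.system) := by
  refine ⟨fun α hα H _ _ _ π hπ => ?_, fun α hα α' hα' H _ _ _ H' _ _ _ π π' hπ hπ' hne => ?_⟩
  · have := (hasFiniteOrbits_of_mem_discreteSpectrum hn hα).finiteDimensional π hπ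
    exact π.isTransitive_system hπ
  · rintro ⟨R, hR⟩
    have := (hasFiniteOrbits_of_mem_discreteSpectrum hn hα).finiteDimensional π hπ
    have := (hasFiniteOrbits_of_mem_discreteSpectrum hn hα').finiteDimensional π' hπ'
    refine hne ?_
    rcases le_total α' α with h | h
    · exact π.unitarilyEquivalent_of_image_system_eq π' h hπ R hR
    · refine (π'.unitarilyEquivalent_of_image_system_eq π h hπ' R.symm fun i => ?_).symm
      rw [← hR i, ← Set.image_comp]
      simp
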